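/- **Setting.** Let $d\ge 2$ and let $T$ be an infinite tree all of whose nodes have degree $d$. Nodes are anonymous; at each node the incident edges carry the port numbers $0,1,\dots,d-1$ in an arbitrary way. Let $z(r)=1+\sum_{k=0}^{r-1} d(d-1)^k$ be the number of nodes at distance at most $r$ from any given node, and let $a(r)=2(z(r)-1)$. An agent has a label $\ell\ge 1$ and starts at some node $v$. Agents move in synchronous rounds: in each round an agent stays idle or leaves its current node by a port it chooses, and on entering a node it learns the port of entry and the degree of the node. An agent that has not yet been woken up stays at its starting node. **Algorithm URT**, for an agent with label $\ell$ starting at $v$. Let $(b_1,\dots,b_k)$ be the sequence obtained from the binary representation of $\ell$ by replacing every bit $1$ by $010101$ and every bit $0$ by $101010$. Let $r_i=2^{2i}$ if $d=2$ and $r_i=2i$ if $d>2$. For $i=0,1,2,\dots$ and, within each $i$, for $j=1,\dots,k$: if $b_j=1$, explore the ball of radius $r_i$ centered at $v$ twice by depth-first search, taking ports in increasing order at each node and each time starting and finishing at $v$ (each exploration takes $a(r_i)$ rounds, one edge per round); if $b_j=0$, stay at $v$ for $2a(r_i)$ rounds. (The algorithm uses only $\ell$, $d$ and the port numbers perceived.)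 **Theorem.** For every $d\ge 2$ there is a constant $C$, depending only on $d$, such that the following holds for every $d$-regular infinite tree $T$ with arbitrary port numbers. Let two agents with different labels from $\{1,\dots,L\}$ start at nodes of $T$ at distance $D$ from each other, be woken up in arbitrary rounds (so with an arbitrary delay between them), and each execute Algorithm URT from its own wakeup. Then the agents meet, i.e. they are at the same node at the end of the same round, and the number of rounds from the wakeup of the earlier agent until the first meeting is at most $C\, z(D)\log L$. In particular the agents, which know neither $D$ nor $L$, meet in time $O(z(D)\log L)$. -/

import Mathlib

universe u

/-- A port labeling: at every node `v` the edges incident to `v` are numbered, in an arbitrary way,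
by `0, 1, …, deg v - 1`. -/
structure PortLabeling {V : Type u} (G : SimpleGraph V) [G.LocallyFinite] where
  port : ∀ v : V, G.neighborSet v ≃ Fin (G.degree v)

/-- The behaviour of an agent over finitely many rounds. In each round the agent either stays
idle or leaves its current node by a port of its choice. After a move it learns the port by which
it entered the new node and the degree of that node, and its further behaviour may depend on
these two numbers (and on nothing else). `done` is the behaviour that takes no rounds. -/
inductive Prog : Type where
  | done : Prog
  | idle (next : Prog) : Prog
  | move (port : ℕ) (next : (entryPort degree : ℕ) → Prog) : Prog

namespace Prog

/-- Execute the first behaviour, then the second. -/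
def seq : Prog → Prog → Prog
  | done, Q => Q
  | idle P, Q => idle (P.seq Q)
  | move p k, Q => move p fun e c => (k e c).seq Q

/-- Execute the behaviours of a list one after another. -/
def seqList : List Prog → Prog
  | [] => done
  | P :: Ps => P.seq (seqList Ps)

/-- Stay idle for `t` rounds. -/
def pass : ℕ → Prog
  | 0 => done
  | t + 1 => idle (pass t)

/-- Depth-first exploration, to depth `r`, of the part of a tree hanging from the current node:
`c` is the degree of the current node and `entry` is the port leading back to the parent
(`none` at the starting node). All other ports are taken in increasing order; through each of
them the agent visits the child, explores there to depth `r - 1`, and comes back through the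
port by which it entered the child. -/
def dfs : (r c : ℕ) → (entry : Option ℕ) → Prog
  | 0, _, _ => done
  | r + 1, c, entry =>
      seqList (((List.range c).filter fun p => entry ≠ some p).map fun p =>
        move p fun e c' => (dfs r c' (some e)).seq (move e fun _ _ => done))

/-- Procedure `ACT`: depth-first exploration of the ball of radius `r` centered at the current
node, which has degree `d`, in increasing order of port numbers. -/
def act (d r : ℕ) : Prog := dfs r d none

end Prog

namespace URT

/-- The number `z(r)` of nodes of a ball of radius `r` in the infinite `d`-regular tree, as an
agent computes it from `d`: one center and `d (d - 1) ^ k` nodes at distance `k + 1`. -/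
def z (d r : ℕ) : ℕ := 1 + ∑ k ∈ Finset.range r, d * (d - 1) ^ k

/-- The number of edge traversals of a depth-first exploration of a ball of radius `r`. -/
def a (d r : ℕ) : ℕ := 2 * (z d r - 1)

/-- The radius of the balls explored in stage `i`. -/
def radius (d i : ℕ) : ℕ := if d = 2 then 2 ^ (2 * i) else 2 * i

/-- The transformed label: every bit `1` of the binary representation of `l` (most significant
bit first) is replaced by `010101`, every bit `0` by `101010`. -/
def trans (l : ℕ) : List Bool :=
  l.bits.reverse.flatMap fun b =>
    if b then [false, true, false, true, false, true]
    else [true, false, true, false, true, false]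

/-- Procedure `Exec(d, b, i)`. -/
def exec (d : ℕ) (b : Bool) (i : ℕ) : Prog :=
  if b then (Prog.act d (radius d i)).seq (Prog.act d (radius d i))
  else Prog.pass (2 * a d (radius d i))

/-- Stage `i` of Algorithm URT for an agent with label `l` in a tree of degree `d`. -/
def stage (l d i : ℕ) : Prog := Prog.seqList ((trans l).map fun b => exec d b i)

/-- Stages `0, 1, …, n - 1` of Algorithm URT for an agent with label `l` in a tree of
degree `d`. -/
def stages (l d n : ℕ) : Prog := Prog.seqList ((List.range n).map fun i => stage l d i)

end URT

namespace PortLabeling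

variable {V : Type u} {G : SimpleGraph V} [G.LocallyFinite]

/-- The node reached from `v` through port `p`, together with the port of entry there.
A port number that does not exist at `v` leaves the agent at `v`. -/
def cross (P : PortLabeling G) (v : V) (p : ℕ) : V × ℕ :=
  if h : p < G.degree v then
    let w : G.neighborSet v := (P.port v).symm ⟨p, h⟩
    (w.1, (P.port w.1 ⟨v, w.2.symm⟩ : ℕ))
  else (v, p)

/-- The nodes occupied after rounds `1, 2, …` by an agent that starts at the given node and
executes the given behaviour. -/
def run (P : PortLabeling G) : Prog → V → List V
  | .done, _ => []
  | .idle Q, v => v :: P.run Q v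
  | .move p k, v =>
      (P.cross v p).1 :: P.run (k (P.cross v p).2 (G.degree (P.cross v p).1)) (P.cross v p).1

/-- The node occupied `t` rounds after its wakeup by an agent with label `l` that starts at `v`
and executes Algorithm URT. Every stage except possibly stage `0` takes at least one round when
all degrees are at least `2` and `l ≥ 1`, so that stages `0, …, t` last for at least `t` rounds,
and the later stages do not matter for the position after `t` rounds. -/
def urtPos (P : PortLabeling G) (l : ℕ) (v : V) (t : ℕ) : V :=
  (v :: P.run (URT.stages l (G.degree v) (t + 1)) v).getD t v

/-- The node occupied at round `t` (of a global clock) by an agent with label `l` that starts at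
`v` and is woken up in round `w`. Before round `w` it stays at `v`: the subtraction is truncated. -/
def urtPosAt (P : PortLabeling G) (l : ℕ) (v : V) (w t : ℕ) : V :=
  P.urtPos l v (t - w)

/-- The two agents, with labels `l₁`, `l₂`, starting nodes `v₁`, `v₂` and wakeup rounds
`w₁`, `w₂`, are at the same node `τ` rounds after the wakeup of the earlier agent. -/
def TogetherAt (P : PortLabeling G) (l₁ l₂ : ℕ) (v₁ v₂ : V) (w₁ w₂ τ : ℕ) : Prop :=
  P.urtPosAt l₁ v₁ w₁ (min w₁ w₂ + τ) = P.urtPosAt l₂ v₂ w₂ (min w₁ w₂ + τ)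

end PortLabeling

/-- The number of nodes at distance at most `r` from `x`. -/
noncomputable def ballSize {V : Type u} (G : SimpleGraph V) (x : V) (r : ℕ) : ℕ :=
  {y : V | G.dist x y ≤ r}.ncard

/-- In a tree, a node other than the root has exactly one neighbor closer to the root. -/
theorem existsUnique_parent {V : Type u} {G : SimpleGraph V} (hG : G.IsTree) (x y : V) (k : ℕ)
    (hy : G.dist x y = k + 1) : ∃! w, G.Adj w y ∧ G.dist x w = k := by
  classical
  obtain ⟨p, hp, hl⟩ := hG.connected.exists_path_of_dist x y
  have hnn : ¬ p.Nil := by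
    intro h
    have := SimpleGraph.Walk.length_eq_zero_iff.mpr h
    omega
  have hpl : p.dropLast.length + 1 = p.length := by
    simp; omega
  have hadj := p.adj_penultimate hnn
  refine ⟨p.penultimate, ⟨hadj, ?_⟩, ?_⟩
  · have h1 := SimpleGraph.dist_le p.dropLast
    have h2 := hG.dist_eq_dist_add_one_of_adj x hadj
    omega
  · rintro w ⟨hw, hwd⟩
    obtain ⟨q, hq, hql⟩ := hG.connected.exists_path_of_dist x w
    have hyq : y ∉ q.support := by
      intro hmem
      have h3 := SimpleGraph.dist_le (q.takeUntil y hmem)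
      have h4 := q.length_takeUntil_le_length hmem
      omega
    have hpath : (q.concat hw).IsPath := hq.concat hyq hw
    have := (hG.existsUnique_path x y).unique hp hpath
    rw [this]; simp

/-- The formula by which agents compute `z(r)` is the size of every ball of radius `r`. -/
theorem ballSize_eq_z {V : Type u} {G : SimpleGraph V} [G.LocallyFinite] (hG : G.IsTree) {d : ℕ}
    (hd : G.IsRegularOfDegree d) (x : V) (r : ℕ) : ballSize G x r = URT.z d r := by
  classical
  have sphere : ∀ k, ∃ s : Finset V, (∀ y, y ∈ s ↔ G.dist x y = k + 1) ∧
      s.card = d * (d - 1) ^ k := by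
    intro k
    induction k with
    | zero =>
      refine ⟨G.neighborFinset x, fun y => ?_, ?_⟩
      · simp [SimpleGraph.dist_eq_one_iff_adj]
      · simpa using hd x
    | succ k ih =>
      obtain ⟨s, hs, hc⟩ := ih
      refine ⟨s.biUnion fun w => (G.neighborFinset w).filter fun y => G.dist x y = k + 2,
        fun y => ?_, ?_⟩
      · simp only [Finset.mem_biUnion, Finset.mem_filter, SimpleGraph.mem_neighborFinset, hs]
        constructor
        · rintro ⟨w, _, _, h⟩; exact h
        · intro h
          obtain ⟨w, ⟨hw, hwd⟩, _⟩ := existsUnique_parent hG x y (k + 1) h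
          exact ⟨w, hwd, hw, h⟩
      · rw [Finset.card_biUnion]
        · rw [Finset.sum_const_nat (m := d - 1), hc, pow_succ, mul_assoc]
          intro w hw
          rw [hs] at hw
          obtain ⟨u, ⟨hu, hud⟩, huniq⟩ := existsUnique_parent hG x w k hw
          have : (G.neighborFinset w).filter (fun y => G.dist x y = k + 2)
              = (G.neighborFinset w).erase u := by
            ext y
            simp only [Finset.mem_filter, Finset.mem_erase, SimpleGraph.mem_neighborFinset]
            constructor
            · rintro ⟨h1, h2⟩
              refine ⟨?_, h1⟩
              rintro rfl; omega
            · rintro ⟨h1, h2⟩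
              refine ⟨h2, ?_⟩
              have h3 := hG.dist_eq_dist_add_one_of_adj x h2
              have h4 : G.dist x y ≠ k := fun h => h1 (huniq y ⟨h2.symm, h⟩)
              omega
          rw [this, Finset.card_erase_of_mem (by simpa using hu.symm),
            SimpleGraph.card_neighborFinset_eq_degree, hd w]
        · intro w hw w' hw' hne
          rw [Function.onFun, Finset.disjoint_left]
          intro y hy hy'
          simp only [Finset.mem_filter, SimpleGraph.mem_neighborFinset, hs, Finset.mem_coe] at *
          exact hne ((existsUnique_parent hG x y (k + 1) hy.2).unique ⟨hy.1, hw⟩ ⟨hy'.1, hw'⟩)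
  have ball : ∃ s : Finset V, (∀ y, y ∈ s ↔ G.dist x y ≤ r) ∧ s.card = URT.z d r := by
    induction r with
    | zero =>
      refine ⟨{x}, fun y => ?_, by simp [URT.z]⟩
      simp [hG.connected.dist_eq_zero_iff, eq_comm]
    | succ r ih =>
      obtain ⟨s, hs, hc⟩ := ih
      obtain ⟨t, ht, hct⟩ := sphere r
      refine ⟨s ∪ t, fun y => ?_, ?_⟩
      · rw [Finset.mem_union, hs, ht]; omega
      · rw [Finset.card_union_of_disjoint, hc, hct, URT.z, URT.z, Finset.sum_range_succ]
        · ring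
        · rw [Finset.disjoint_left]
          intro y hy hy'
          rw [hs] at hy; rw [ht] at hy'; omega
  obtain ⟨s, hs, hc⟩ := ball
  rw [ballSize, ← hc, ← Set.ncard_coe_finset]
  congr 1
  ext y
  simp [hs]

theorem le_length_run_seq_left {V : Type u} {G : SimpleGraph V} [G.LocallyFinite]
    (P : PortLabeling G) (A B : Prog) (v : V) :
    (P.run A v).length ≤ (P.run (A.seq B) v).length := by
  induction A generalizing v with
  | done => simp [PortLabeling.run]
  | idle A ih => simpa [Prog.seq, PortLabeling.run] using ih v
  | move p k ih => simpa [Prog.seq, PortLabeling.run] using ih _ _ _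

theorem le_length_run_seq {V : Type u} {G : SimpleGraph V} [G.LocallyFinite]
    (P : PortLabeling G) {m n : ℕ} (A B : Prog) (hA : ∀ v, m ≤ (P.run A v).length)
    (hB : ∀ v, n ≤ (P.run B v).length) (v : V) : m + n ≤ (P.run (A.seq B) v).length := by
  have key : ∀ v, (P.run A v).length + n ≤ (P.run (A.seq B) v).length := by
    clear hA
    intro v
    induction A generalizing v with
    | done => simpa [Prog.seq, PortLabeling.run] using hB v
    | idle A ih =>
      have := ih v
      simp only [Prog.seq, PortLabeling.run, List.length_cons]; omega
    | move p k ih =>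
      have := ih (P.cross v p).2 (G.degree (P.cross v p).1) (P.cross v p).1
      simp only [Prog.seq, PortLabeling.run, List.length_cons]; omega
  have := hA v
  have := key v
  omega

theorem le_length_run_seqList {V : Type u} {G : SimpleGraph V} [G.LocallyFinite]
    (P : PortLabeling G) {m : ℕ} (As : List Prog) (A : Prog) (hA : A ∈ As)
    (hm : ∀ v, m ≤ (P.run A v).length) (v : V) : m ≤ (P.run (Prog.seqList As) v).length := by
  induction As generalizing v with
  | nil => simp at hA
  | cons B Bs ih =>
    rcases List.mem_cons.mp hA with rfl | h
    · exact (hm v).trans (le_length_run_seq_left P _ _ v)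
    · have := le_length_run_seq P B (Prog.seqList Bs) (m := 0) (fun _ => Nat.zero_le _) (ih h) v
      simpa [Prog.seqList] using this

theorem length_run_pass {V : Type u} {G : SimpleGraph V} [G.LocallyFinite]
    (P : PortLabeling G) (t : ℕ) (v : V) : (P.run (Prog.pass t) v).length = t := by
  induction t with
  | zero => rfl
  | succ t ih => simpa [Prog.pass, PortLabeling.run] using ih

/-- Stages `0, …, t` of Algorithm URT last for at least `t` rounds. -/
theorem le_length_run_stages {V : Type u} {G : SimpleGraph V} [G.LocallyFinite]
    (P : PortLabeling G) {l d : ℕ} (hl : 1 ≤ l) (hd : 2 ≤ d) (t : ℕ) (v : V) :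
    t ≤ (P.run (URT.stages l d (t + 1)) v).length := by
  have hmem : false ∈ URT.trans l := by
    have hb : l.bits ≠ [] := by
      intro h
      have := congrArg List.length h
      rw [Nat.size_eq_bits_len] at this
      have := Nat.size_eq_zero.mp this
      omega
    obtain ⟨b, hb⟩ := List.exists_mem_of_ne_nil _ hb
    rw [URT.trans, List.mem_flatMap]
    exact ⟨b, by simpa using hb, by cases b <;> simp⟩
  have hstage : ∀ i, 1 ≤ i → ∀ v, 1 ≤ (P.run (URT.stage l d i) v).length := by
    intro i hi
    refine le_length_run_seqList P _ (URT.exec d false i) (List.mem_map_of_mem hmem) fun v => ?_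
    have hr : 1 ≤ URT.radius d i := by
      unfold URT.radius
      split_ifs
      · exact Nat.one_le_two_pow
      · omega
    have hz : d * (d - 1) ^ 0 ≤ ∑ k ∈ Finset.range (URT.radius d i), d * (d - 1) ^ k :=
      Finset.single_le_sum (f := fun k => d * (d - 1) ^ k) (fun _ _ => Nat.zero_le _)
        (Finset.mem_range.mpr hr)
    simp only [URT.exec, Bool.false_eq_true, if_false, length_run_pass, URT.a, URT.z]
    simp only [pow_zero, mul_one] at hz
    omega
  have aux : ∀ (is : List ℕ), (∀ i ∈ is, 1 ≤ i) → ∀ v,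
      is.length ≤ (P.run (Prog.seqList (is.map fun i => URT.stage l d i)) v).length := by
    intro is
    induction is with
    | nil => simp
    | cons i is ih =>
      intro h v
      have := le_length_run_seq P _ _ (hstage i (h i (by simp)))
        (ih fun j hj => h j (by simp [hj])) v
      simpa [Prog.seqList, add_comm] using this
  rw [URT.stages, List.range_succ_eq_map, List.map_cons, Prog.seqList]
  have := le_length_run_seq P (URT.stage l d 0) _ (m := 0) (fun _ => Nat.zero_le _)
    (aux ((List.range t).map Nat.succ) (by simp)) v
  simpa using this

/-! Every exploration is a closed walk of exactly `a d r` rounds (`isLoop_act`) that reaches the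
whole ball (`mem_run_act`). Hence each agent follows a fixed `Timetable`: stage `n` consists of
equal blocks of `2 * a n` rounds, where `a n` abbreviates `a d (radius d n)`. From the first stage
`i` with radius at least `D`, each half of a block with bit `1` visits the other agent's starting
node; blocks with bit `0` are spent at home.

Suppose that one agent starts stage `n + 1` first, when both have reached stage `i`. If the other
lags by at least `4 * a n`, it is busy with shorter blocks, and since bits come in pairs `01`, `10`,
it completes an active block within `8 * a n` rounds. These fit into the leader's first block, which
is idle because transformed labels start with `0` and `4 * a n ≤ a (n + 1)`. If it lags less,
equally numbered blocks overlap in more than half their length: a differing bit gives a meeting,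
because active blocks explore twice. Otherwise the transformed labels differ in length, by at least
`6`, so one agent is far behind at the start of stage `n + 2` and the first case applies
(`Timetable.exists_meet_of_stageStart_le`).

For the time bound (`Timetable.exists_meet_le`), a second agent that is still asleep when the first
ends stage `i` is found at home. Otherwise both reach stage `i` within `O(K * a i)` rounds, `K`
bounding the label lengths. In the least suitable stage, some agent started the preceding stage
early enough for its stage lengths to be `O(K * a i)`, since stage lengths grow by a factor of at
most `d * d`. Finally `a i` is `O(z(D))` and `K` is `O(log L)`. -/

/-! ### Duration and reach of depth-first exploration -/

namespace PortLabeling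

variable {V : Type u} {G : SimpleGraph V} [G.LocallyFinite]

/-- Executed from `v`, the behaviour `Q` takes `n` rounds and ends at `v`. -/
structure IsLoop (P : PortLabeling G) (Q : Prog) (v : V) (n : ℕ) : Prop where
  length_eq : (P.run Q v).length = n
  getLastD_eq : (P.run Q v).getLastD v = v

theorem getLastD_append (l m : List V) (v : V) :
    (l ++ m).getLastD v = m.getLastD (l.getLastD v) := by
  induction l generalizing v with
  | nil => rfl
  | cons x l ih => rw [List.cons_append, List.getLastD_cons, List.getLastD_cons, ih]

theorem run_seq (P : PortLabeling G) (A B : Prog) (v : V) :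
    P.run (A.seq B) v = P.run A v ++ P.run B ((P.run A v).getLastD v) := by
  induction A generalizing v with
  | done => simp [Prog.seq, run]
  | idle A ih => rw [Prog.seq, run, run, ih, List.cons_append, List.getLastD_cons]
  | move p k ih => rw [Prog.seq, run, run, ih, List.cons_append, List.getLastD_cons]

theorem IsLoop.run_seq {P : PortLabeling G} {A : Prog} {v : V} {n : ℕ} (h : P.IsLoop A v n)
    (B : Prog) : P.run (A.seq B) v = P.run A v ++ P.run B v := by
  rw [PortLabeling.run_seq, h.getLastD_eq]

theorem IsLoop.seq {P : PortLabeling G} {A B : Prog} {v : V} {m n : ℕ} (hA : P.IsLoop A v m)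
    (hB : P.IsLoop B v n) : P.IsLoop (A.seq B) v (m + n) where
  length_eq := by rw [hA.run_seq, List.length_append, hA.length_eq, hB.length_eq]
  getLastD_eq := by rw [hA.run_seq, getLastD_append, hA.getLastD_eq, hB.getLastD_eq]

theorem IsLoop.done (P : PortLabeling G) (v : V) : P.IsLoop .done v 0 := ⟨rfl, rfl⟩

theorem IsLoop.seqList {ι : Type*} {P : PortLabeling G} {v : V} {f : ι → Prog} {n : ι → ℕ}
    (Qs : List ι) (h : ∀ q ∈ Qs, P.IsLoop (f q) v (n q)) :
    P.IsLoop (Prog.seqList (Qs.map f)) v (Qs.map n).sum := by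
  induction Qs with
  | nil => exact IsLoop.done P v
  | cons q Qs ih =>
    simpa [Prog.seqList] using
      (h q (by simp)).seq (ih fun q' hq' => h q' (by simp [hq']))

theorem IsLoop.run_seqList {ι : Type*} {P : PortLabeling G} {v : V} {f : ι → Prog} {n : ι → ℕ}
    (Qs : List ι) (h : ∀ q ∈ Qs, P.IsLoop (f q) v (n q)) :
    P.run (Prog.seqList (Qs.map f)) v = Qs.flatMap fun q => P.run (f q) v := by
  induction Qs with
  | nil => rfl
  | cons q Qs ih =>
    rw [List.map_cons, Prog.seqList, (h q (by simp)).run_seq, List.flatMap_cons,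
      ih fun q' hq' => h q' (by simp [hq'])]

theorem run_pass (P : PortLabeling G) (t : ℕ) (v : V) :
    P.run (Prog.pass t) v = List.replicate t v := by
  induction t with
  | zero => rfl
  | succ t ih => rw [Prog.pass, run, ih, List.replicate_succ]

theorem IsLoop.pass (P : PortLabeling G) (t : ℕ) (v : V) : P.IsLoop (Prog.pass t) v t where
  length_eq := length_run_pass P t v
  getLastD_eq := by
    rw [run_pass]
    cases t with
    | zero => rfl
    | succ t => simp [List.replicate_succ']

theorem cross_port (P : PortLabeling G) {v w : V} (h : G.Adj v w) :
    P.cross v (P.port v ⟨w, h⟩) = (w, (P.port w ⟨v, h.symm⟩ : ℕ)) := by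
  have hlt : (P.port v ⟨w, h⟩ : ℕ) < G.degree v := (P.port v ⟨w, h⟩).2
  have hw : (P.port v).symm ⟨P.port v ⟨w, h⟩, hlt⟩ = ⟨w, h⟩ := (P.port v).symm_apply_apply _
  have key : ∀ x : G.neighborSet v, x = ⟨w, h⟩ →
      (x.1, (P.port x.1 ⟨v, x.2.symm⟩ : ℕ)) = (w, (P.port w ⟨v, h.symm⟩ : ℕ)) := by
    rintro x rfl
    rfl
  rw [cross, dif_pos hlt]
  exact key _ hw

theorem cross_of_lt (P : PortLabeling G) {v : V} {p : ℕ} (hp : p < G.degree v) :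
    ∃ (w : V) (h : G.Adj v w), p = P.port v ⟨w, h⟩ := by
  refine ⟨((P.port v).symm ⟨p, hp⟩).1, ((P.port v).symm ⟨p, hp⟩).2, ?_⟩
  simp

/-- The number of rounds of a depth-first exploration to depth `r` below a node other than the
root. -/
def subtreeLength (d : ℕ) : ℕ → ℕ
  | 0 => 0
  | r + 1 => (d - 1) * (subtreeLength d r + 2)

theorem two_mul_sum_eq (d r : ℕ) :
    2 * ∑ k ∈ Finset.range (r + 1), (d - 1) ^ k = subtreeLength d r + 2 := by
  induction r with
  | zero => simp [subtreeLength]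
  | succ r ih =>
    rw [Finset.sum_range_succ', subtreeLength, ← ih]
    simp only [pow_succ, ← Finset.sum_mul]
    ring

/-- This matches the agents' formula with the actual walk: each of the `d` branches at the root
costs two edge traversals plus the exploration below it. -/
theorem a_succ_eq (d r : ℕ) : URT.a d (r + 1) = d * (subtreeLength d r + 2) := by
  rw [← two_mul_sum_eq, URT.a, URT.z, ← Finset.mul_sum, Nat.add_sub_cancel_left]
  ring

/-- Visit the neighbor behind port `p`, explore the part of the tree hanging from it to depth `r`,
and come back. -/
def visit (r p : ℕ) : Prog :=
  .move p fun e c' => (Prog.dfs r c' (some e)).seq (.move e fun _ _ => .done)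

theorem run_visit (P : PortLabeling G) {d r n : ℕ} (hd : G.IsRegularOfDegree d) {v w : V}
    (h : G.Adj v w) (hl : P.IsLoop (Prog.dfs r d (some (P.port w ⟨v, h.symm⟩ : ℕ))) w n) :
    P.run (visit r (P.port v ⟨w, h⟩)) v =
      w :: (P.run (Prog.dfs r d (some (P.port w ⟨v, h.symm⟩ : ℕ))) w ++ [v]) := by
  rw [visit, run, P.cross_port h]
  simp only [hd.degree_eq]
  rw [hl.run_seq, run, P.cross_port h.symm, run]

theorem IsLoop.visit (P : PortLabeling G) {d r n : ℕ} (hd : G.IsRegularOfDegree d) {v w : V}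
    (h : G.Adj v w) (hl : P.IsLoop (Prog.dfs r d (some (P.port w ⟨v, h.symm⟩ : ℕ))) w n) :
    P.IsLoop (visit r (P.port v ⟨w, h⟩)) v (n + 2) where
  length_eq := by
    rw [run_visit P hd h hl]
    simp [hl.length_eq]
  getLastD_eq := by
    rw [run_visit P hd h hl, ← List.cons_append, getLastD_append]
    rfl

theorem dfs_succ (r d : ℕ) (entry : Option ℕ) :
    Prog.dfs (r + 1) d entry =
      Prog.seqList (((List.range d).filter fun p => entry ≠ some p).map (visit r)) := rfl

theorem length_filter_range {d e : ℕ} (he : e < d) :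
    ((List.range d).filter fun p => some e ≠ some p).length = d - 1 := by
  have h : ((List.range d).filter fun p => some e ≠ some p) = (List.range d).erase e := by
    rw [(List.nodup_range).erase_eq_filter]
    refine List.filter_congr fun p _ => ?_
    by_cases hp : p = e
    · simp [hp]
    · simp [hp, Ne.symm hp]
  rw [h, List.length_erase_of_mem (by simpa using he), List.length_range]

theorem isLoop_visit_of_isLoop_dfs (P : PortLabeling G) {d r : ℕ} (hd : G.IsRegularOfDegree d)
    (ih : ∀ (v : V) (e : ℕ), e < d → P.IsLoop (Prog.dfs r d (some e)) v (subtreeLength d r))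
    (v : V) {p : ℕ} (hp : p < d) : P.IsLoop (visit r p) v (subtreeLength d r + 2) := by
  obtain ⟨w, hw, rfl⟩ := P.cross_of_lt (v := v) (p := p) (by rwa [hd.degree_eq])
  exact IsLoop.visit P hd hw (ih w _ (by simpa [hd.degree_eq] using (P.port w ⟨v, hw.symm⟩).2))

/-- Duration and closedness go through the induction together: the return port is the right one only
because the exploration below a child ends at that child. -/
theorem isLoop_dfs (P : PortLabeling G) {d : ℕ} (hd : G.IsRegularOfDegree d) (r : ℕ) :
    ∀ (v : V) (e : ℕ), e < d → P.IsLoop (Prog.dfs r d (some e)) v (subtreeLength d r) := by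
  induction r with
  | zero => intro v e _; exact IsLoop.done P v
  | succ r ih =>
    intro v e he
    rw [dfs_succ]
    have := IsLoop.seqList (P := P) (v := v) (f := visit r) (n := fun _ => subtreeLength d r + 2)
      ((List.range d).filter fun p => some e ≠ some p) fun p hp =>
        isLoop_visit_of_isLoop_dfs P hd ih v (by simp at hp; exact hp.1)
    rwa [List.map_const', List.sum_replicate, length_filter_range he] at this

theorem isLoop_act (P : PortLabeling G) {d : ℕ} (hd : G.IsRegularOfDegree d) (r : ℕ) (v : V) :
    P.IsLoop (Prog.act d r) v (URT.a d r) := by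
  cases r with
  | zero => exact IsLoop.done P v
  | succ r =>
    rw [Prog.act, dfs_succ, a_succ_eq]
    have := IsLoop.seqList (P := P) (v := v) (f := visit r) (n := fun _ => subtreeLength d r + 2)
      ((List.range d).filter fun p => none ≠ some p) fun p hp =>
        isLoop_visit_of_isLoop_dfs P hd (isLoop_dfs P hd r) v (by simpa using hp)
    rw [List.map_const', List.sum_replicate] at this
    simpa using this

/-- A depth-first exploration to depth `r` reaches the end of every path of length at most `r`
that avoids the parent of the starting node. -/
theorem mem_run_dfs (P : PortLabeling G) {d : ℕ} (hd : G.IsRegularOfDegree d) {v u : V}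
    (q : G.Walk v u) (hq : q.IsPath) (r : ℕ) (hr : q.length ≤ r) (entry : Option ℕ)
    (hentry : ∀ w (h : G.Adj v w), entry = some (P.port v ⟨w, h⟩ : ℕ) → w ∉ q.support) :
    u ∈ v :: P.run (Prog.dfs r d entry) v := by
  induction q generalizing r entry with
  | nil => simp
  | @cons v w u h q ih =>
    obtain ⟨r, rfl⟩ : ∃ r', r = r' + 1 := ⟨r - 1, by simp at hr; omega⟩
    rw [SimpleGraph.Walk.cons_isPath_iff] at hq
    have hl := isLoop_dfs P hd r w (P.port w ⟨v, h.symm⟩)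
      (by simpa [hd.degree_eq] using (P.port w ⟨v, h.symm⟩).2)
    have hmem : u ∈ P.run (visit r (P.port v ⟨w, h⟩)) v := by
      rw [run_visit P hd h hl, ← List.cons_append, List.mem_append]
      -- The port excluded at `w` leads back to `v`, and `v` is not on the rest of the path.
      refine Or.inl (ih hq.1 r (by simpa using hr) _ fun x hx hxe => ?_)
      have : x = v := by
        have h1 := (P.port w).injective (Fin.ext (Option.some.inj hxe))
        exact (congrArg Subtype.val h1).symm
      rw [this]
      exact hq.2
    rw [dfs_succ, IsLoop.run_seqList (n := fun _ => subtreeLength d r + 2)]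
    · refine List.mem_cons_of_mem _ (List.mem_flatMap.mpr ⟨_, ?_, hmem⟩)
      have hlt : (P.port v ⟨w, h⟩ : ℕ) < d := (P.port v ⟨w, h⟩).2.trans_eq (hd.degree_eq v)
      simp only [List.mem_filter, List.mem_range, decide_eq_true_eq]
      refine ⟨hlt, fun he => hentry w h he (by simp)⟩
    · intro p hp
      exact isLoop_visit_of_isLoop_dfs P hd (isLoop_dfs P hd r) v (by simp at hp; exact hp.1)

theorem mem_run_act (P : PortLabeling G) {d r : ℕ} (hG : G.Connected) (hd : G.IsRegularOfDegree d)
    {v u : V} (hr : G.dist v u ≤ r) : u ∈ v :: P.run (Prog.act d r) v := by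
  obtain ⟨q, hq, hl⟩ := hG.exists_path_of_dist v u
  exact mem_run_dfs P hd q hq r (by omega) none (by simp)

/-! ### The timetable of Algorithm URT -/

theorem isLoop_exec (P : PortLabeling G) {d : ℕ} (hd : G.IsRegularOfDegree d) (b : Bool) (i : ℕ)
    (v : V) : P.IsLoop (URT.exec d b i) v (2 * URT.a d (URT.radius d i)) := by
  cases b with
  | false => exact IsLoop.pass P _ v
  | true =>
    have := (isLoop_act P hd (URT.radius d i) v).seq (isLoop_act P hd (URT.radius d i) v)
    rwa [← two_mul] at this

theorem isLoop_stage (P : PortLabeling G) {d : ℕ} (hd : G.IsRegularOfDegree d) (l i : ℕ)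
    (v : V) : P.IsLoop (URT.stage l d i) v
      ((URT.trans l).length * (2 * URT.a d (URT.radius d i))) := by
  have := IsLoop.seqList (P := P) (v := v) (f := fun b => URT.exec d b i)
    (n := fun _ => 2 * URT.a d (URT.radius d i)) (URT.trans l)
    fun b _ => isLoop_exec P hd b i v
  rwa [List.map_const', List.sum_replicate] at this

theorem run_stage (P : PortLabeling G) {d : ℕ} (hd : G.IsRegularOfDegree d) (l i : ℕ)
    (v : V) : P.run (URT.stage l d i) v =
      (URT.trans l).flatMap fun b => P.run (URT.exec d b i) v :=
  IsLoop.run_seqList _ fun b _ => isLoop_exec P hd b i v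

theorem isLoop_stages (P : PortLabeling G) {d : ℕ} (hd : G.IsRegularOfDegree d) (l n : ℕ)
    (v : V) : P.IsLoop (URT.stages l d n) v
      (2 * (URT.trans l).length * ∑ i ∈ Finset.range n, URT.a d (URT.radius d i)) := by
  have := IsLoop.seqList (P := P) (v := v) (f := fun i => URT.stage l d i)
    (List.range n) fun i _ => isLoop_stage P hd l i v
  have e : 2 * (URT.trans l).length * ∑ i ∈ Finset.range n, URT.a d (URT.radius d i) =
      ((List.range n).map fun i => (URT.trans l).length * (2 * URT.a d (URT.radius d i))).sum := by
    clear this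
    induction n with
    | zero => simp
    | succ n ih =>
      rw [List.range_succ, List.map_append, List.sum_append, ← ih, Finset.sum_range_succ, mul_add]
      simp only [List.map_cons, List.map_nil, List.sum_cons, List.sum_nil]
      ring
  rw [e]
  exact this

theorem run_stages (P : PortLabeling G) {d : ℕ} (hd : G.IsRegularOfDegree d) (l n : ℕ)
    (v : V) : P.run (URT.stages l d n) v =
      (List.range n).flatMap fun i => P.run (URT.stage l d i) v :=
  IsLoop.run_seqList _ fun i _ => isLoop_stage P hd l i v

theorem run_stages_add (P : PortLabeling G) {d : ℕ} (hd : G.IsRegularOfDegree d) (l m n : ℕ)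
    (v : V) : ∃ S, P.run (URT.stages l d (m + n)) v = P.run (URT.stages l d m) v ++ S := by
  rw [run_stages P hd, run_stages P hd, List.range_add, List.flatMap_append]
  exact ⟨_, rfl⟩

/-- Runs over different numbers of stages are prefixes of one another, so any run that is long
enough determines the position. -/
theorem urtPos_eq (P : PortLabeling G) {d : ℕ} (hd : G.IsRegularOfDegree d) (h2 : 2 ≤ d) {l : ℕ}
    (hl : 1 ≤ l) (v : V) (t n : ℕ) (hn : t ≤ (P.run (URT.stages l d n) v).length) :
    P.urtPos l v t = (v :: P.run (URT.stages l d n) v).getD t v := by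
  have ht := le_length_run_stages P hl h2 t v
  rw [urtPos, hd.degree_eq]
  rcases le_total n (t + 1) with h | h
  · obtain ⟨k, hk⟩ := Nat.exists_eq_add_of_le h
    obtain ⟨S, hS⟩ := run_stages_add P hd l n k v
    rw [hk, hS, ← List.cons_append, List.getD_append _ _ _ _ (by simp; omega)]
  · obtain ⟨k, hk⟩ := Nat.exists_eq_add_of_le h
    obtain ⟨S, hS⟩ := run_stages_add P hd l (t + 1) k v
    rw [hk, hS, ← List.cons_append, List.getD_append _ _ _ _ (by simp; omega)]

theorem getD_cons_append (A B C : List V) (v : V) (hA : A.getLastD v = v) {t : ℕ}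
    (ht : t ≤ B.length) : (v :: (A ++ (B ++ C))).getD (A.length + t) v = (v :: B).getD t v := by
  rcases t with _ | t
  -- Offset `0` is the last entry of `A`, or the prepended start if `A` is empty; both are `v`, as
  -- `A` is closed.
  · rcases A.eq_nil_or_concat with rfl | ⟨A', x, rfl⟩
    · simp
    · have hx : x = v := by simpa [getLastD_append] using hA
      subst hx
      simp
  · rw [← add_assoc, List.getD_cons_succ, List.getD_cons_succ,
      List.getD_append_right _ _ _ _ (by omega), Nat.add_sub_cancel_left,
      List.getD_append _ _ _ _ (by omega)]

/-- The position of an agent during block `j` of stage `n`. -/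
theorem urtPos_block (P : PortLabeling G) {d : ℕ} (hd : G.IsRegularOfDegree d) (h2 : 2 ≤ d) {l : ℕ}
    (hl : 1 ≤ l) (v : V) (n j t : ℕ) (hj : j < (URT.trans l).length)
    (ht : t ≤ 2 * URT.a d (URT.radius d n)) :
    P.urtPos l v (2 * (URT.trans l).length * (∑ i ∈ Finset.range n, URT.a d (URT.radius d i)) +
        2 * URT.a d (URT.radius d n) * j + t) =
      (v :: P.run (URT.exec d ((URT.trans l).getD j false) n) v).getD t v := by
  set A := P.run (URT.stages l d n) v ++
    ((URT.trans l).take j).flatMap fun b => P.run (URT.exec d b n) v with hA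
  set B := P.run (URT.exec d ((URT.trans l).getD j false) n) v with hB
  set C := ((URT.trans l).drop (j + 1)).flatMap fun b => P.run (URT.exec d b n) v with hC
  have hpre : P.IsLoop (Prog.seqList (((URT.trans l).take j).map fun b => URT.exec d b n)) v
      (2 * URT.a d (URT.radius d n) * j) := by
    have := IsLoop.seqList (P := P) (v := v) (f := fun b => URT.exec d b n)
      ((URT.trans l).take j) fun b _ => isLoop_exec P hd b n v
    rw [List.map_const', List.sum_replicate, List.length_take, min_eq_left hj.le] at this
    convert this using 1
    rw [smul_eq_mul, mul_comm]
  have hAloop := (isLoop_stages P hd l n v).seq hpre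
  have hArun : A = P.run ((URT.stages l d n).seq
      (Prog.seqList (((URT.trans l).take j).map fun b => URT.exec d b n))) v := by
    rw [(isLoop_stages P hd l n v).run_seq, IsLoop.run_seqList _ fun b _ => isLoop_exec P hd b n v]
  have hBl : B.length = 2 * URT.a d (URT.radius d n) := (isLoop_exec P hd _ n v).length_eq
  have hrun : P.run (URT.stages l d (n + 1)) v = A ++ (B ++ C) := by
    rw [run_stages P hd, List.range_succ, List.flatMap_append, ← run_stages P hd,
      List.flatMap_singleton, run_stage P hd, hA, List.append_assoc]
    congr 1
    have hsplit : URT.trans l = (URT.trans l).take j ++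
        ((URT.trans l).getD j false :: (URT.trans l).drop (j + 1)) := by
      rw [List.getD_eq_getElem _ _ hj, List.getElem_cons_drop, List.take_append_drop]
    conv_lhs => rw [hsplit]
    rw [List.flatMap_append, List.flatMap_cons]
  have hAl := hAloop.length_eq
  rw [← hArun] at hAl
  rw [urtPos_eq P hd h2 hl v _ (n + 1), hrun, ← hAl]
  · refine getD_cons_append A B C v ?_ (by omega)
    rw [hArun]; exact hAloop.getLastD_eq
  · rw [hrun, ← hAl]
    simp only [List.length_append]; omega

theorem urtPos_idle (P : PortLabeling G) {d : ℕ} (hd : G.IsRegularOfDegree d) (h2 : 2 ≤ d) {l : ℕ}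
    (hl : 1 ≤ l) (v : V) (n j t : ℕ) (hj : j < (URT.trans l).length)
    (hb : (URT.trans l).getD j false = false) (ht : t ≤ 2 * URT.a d (URT.radius d n)) :
    P.urtPos l v (2 * (URT.trans l).length * (∑ i ∈ Finset.range n, URT.a d (URT.radius d i)) +
        2 * URT.a d (URT.radius d n) * j + t) = v := by
  rw [urtPos_block P hd h2 hl v n j t hj ht, hb]
  simp only [URT.exec, Bool.false_eq_true, if_false, run_pass, ← List.replicate_succ]
  rw [List.getD_replicate _ (by omega)]

theorem urtPos_active (P : PortLabeling G) {d : ℕ} (hG : G.Connected) (hd : G.IsRegularOfDegree d)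
    (h2 : 2 ≤ d) {l : ℕ} (hl : 1 ≤ l) (v u : V) (n j h : ℕ) (hj : j < (URT.trans l).length)
    (hb : (URT.trans l).getD j false = true) (hu : G.dist v u ≤ URT.radius d n) (hh : h ≤ 1) :
    ∃ t ≤ URT.a d (URT.radius d n),
      P.urtPos l v (2 * (URT.trans l).length * (∑ i ∈ Finset.range n, URT.a d (URT.radius d i)) +
        2 * URT.a d (URT.radius d n) * j + (h * URT.a d (URT.radius d n) + t)) = u := by
  have hloop := isLoop_act P hd (URT.radius d n) v
  obtain ⟨t, ht, hut⟩ := List.mem_iff_getElem.mp (mem_run_act P hG hd hu)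
  have hta : t ≤ URT.a d (URT.radius d n) := by
    rw [List.length_cons, hloop.length_eq] at ht; omega
  refine ⟨t, hta, ?_⟩
  rw [urtPos_block P hd h2 hl v n j _ hj (by interval_cases h <;> omega), hb]
  simp only [URT.exec, if_true]
  rw [hloop.run_seq, ← hut, ← List.getD_eq_getElem _ v ht]
  interval_cases h
  · rw [zero_mul, zero_add, ← List.cons_append, List.getD_append _ _ _ _ ht]
  · have := getD_cons_append (P.run (Prog.act d (URT.radius d n)) v)
      (P.run (Prog.act d (URT.radius d n)) v) [] v hloop.getLastD_eq (t := t)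
      (by rw [hloop.length_eq]; exact hta)
    rwa [List.append_nil, hloop.length_eq, ← one_mul (URT.a d (URT.radius d n))] at this

end PortLabeling

/-! ### Meeting of two abstract timetables -/

/-- The round in which an agent woken up in round `w` with bit sequence `b` starts stage `n`, where
blocks of stage `m` take `2 * a m` rounds. -/
def stageStart (a : ℕ → ℕ) (b : List Bool) (w n : ℕ) : ℕ :=
  w + 2 * b.length * ∑ m ∈ Finset.range n, a m

theorem stageStart_succ (a : ℕ → ℕ) (b : List Bool) (w n : ℕ) :
    stageStart a b w (n + 1) = stageStart a b w n + 2 * a n * b.length := by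
  rw [stageStart, stageStart, Finset.sum_range_succ]
  ring

theorem stageStart_mono (a : ℕ → ℕ) (b : List Bool) (w : ℕ) : Monotone (stageStart a b w) :=
  monotone_nat_of_le_succ fun n => by rw [stageStart_succ]; omega

theorem le_stageStart (a : ℕ → ℕ) (b : List Bool) (w n : ℕ) : w ≤ stageStart a b w n :=
  Nat.le_add_right _ _

/-- The trajectory `pos` follows the timetable of an agent woken up in round `w` at `home` with bit
sequence `b`: in a block with bit `0` it stays at `home`, and from stage `i` on, it visits `target`
in both halves of every block with bit `1`. -/
structure Timetable {V : Type u} (a : ℕ → ℕ) (i : ℕ) (b : List Bool) (w : ℕ) (home target : V)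
    (pos : ℕ → V) : Prop where
  asleep : ∀ t ≤ w, pos t = home
  idle : ∀ n, ∀ j < b.length, b.getD j false = false → ∀ t ≤ 2 * a n,
    pos (stageStart a b w n + 2 * a n * j + t) = home
  active : ∀ n, i ≤ n → ∀ j < b.length, b.getD j false = true → ∀ h ≤ 1, ∃ t ≤ a n,
    pos (stageStart a b w n + 2 * a n * j + (h * a n + t)) = target

/-- A nonempty sequence of pairs `01` and `10` that starts with `01`. -/
structure IsPaired (b : List Bool) : Prop where
  even : Even b.length
  pos : 0 < b.length
  ne : ∀ q, 2 * q < b.length → b.getD (2 * q) false ≠ b.getD (2 * q + 1) false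
  head : b.getD 0 false = false

section

variable {V : Type u} {a : ℕ → ℕ} {i : ℕ} {b b' : List Bool} {w w' : ℕ} {v v' : V}
  {pos pos' : ℕ → V}

theorem IsPaired.exists_true (hb : IsPaired b) {q : ℕ} (hq : 2 * q < b.length) :
    ∃ j, 2 * q ≤ j ∧ j ≤ 2 * q + 1 ∧ j < b.length ∧ b.getD j false = true := by
  have h1 := hb.ne q hq
  obtain ⟨h, hh⟩ := hb.even
  cases h0 : b.getD (2 * q) false with
  | true => exact ⟨2 * q, by omega, by omega, hq, h0⟩
  | false =>
    refine ⟨2 * q + 1, by omega, by omega, by omega, ?_⟩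
    rw [h0] at h1
    simpa using h1.symm

/-- Every long enough time window contains a block with bit `1`. -/
theorem IsPaired.exists_active_block (hb : IsPaired b) (ha : Monotone a)
    (hpos : ∀ m, i ≤ m → 0 < a m) {n T : ℕ} (hin : i ≤ n) (hT : stageStart a b w i ≤ T)
    (hTn : T + 4 * a n ≤ stageStart a b w (n + 1)) :
    ∃ m j, i ≤ m ∧ j < b.length ∧ b.getD j false = true ∧ T ≤ stageStart a b w m + 2 * a m * j ∧
      stageStart a b w m + 2 * a m * j + 2 * a m ≤ T + 8 * a n := by
  have hn0 := hpos n hin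
  obtain ⟨m, him, hmn, hm, hm'⟩ : ∃ m, i ≤ m ∧ m ≤ n ∧ stageStart a b w m ≤ T ∧
      T < stageStart a b w (m + 1) := by
    have hex : ∃ m, T < stageStart a b w (m + 1) := ⟨n, by omega⟩
    classical
    have hspec := Nat.find_spec hex
    have hmin : Nat.find hex ≤ n := Nat.find_min' hex (by omega)
    have hi : i ≤ Nat.find hex := by
      by_contra hlt
      have := stageStart_mono a b w (show Nat.find hex + 1 ≤ i by omega)
      omega
    refine ⟨Nat.find hex, hi, hmin, ?_, hspec⟩
    rcases hi.eq_or_lt with h | h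
    · rwa [← h]
    · have := Nat.find_min hex (m := Nat.find hex - 1) (by omega)
      rw [Nat.sub_add_cancel (by omega)] at this
      omega
  have ham := ha hmn
  have hm0 := hpos m him
  -- Rounding up: pair `q` is the first pair of blocks of stage `m` that starts at or after `T`. A
  -- pair lasts `4 * a m` rounds, so it ends by `T + 8 * a m`.
  set q := (T - stageStart a b w m + (4 * a m - 1)) / (4 * a m) with hq
  have hq1 : T - stageStart a b w m ≤ 4 * a m * q := by
    have := Nat.lt_mul_div_succ (T - stageStart a b w m + (4 * a m - 1))
      (show 0 < 4 * a m by omega)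
    rw [← hq, mul_add] at this
    omega
  have hq2 : 4 * a m * q ≤ T - stageStart a b w m + (4 * a m - 1) := Nat.mul_div_le _ _
  by_cases hqk : 2 * q < b.length
  · obtain ⟨j, hj1, hj2, hj, hbj⟩ := hb.exists_true hqk
    refine ⟨m, j, him, hj, hbj, ?_, ?_⟩
    · have : 2 * a m * (2 * q) ≤ 2 * a m * j := Nat.mul_le_mul_left _ hj1
      have e : 2 * a m * (2 * q) = 4 * a m * q := by ring
      omega
    · have : 2 * a m * j ≤ 2 * a m * (2 * q + 1) := Nat.mul_le_mul_left _ hj2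
      have e : 2 * a m * (2 * q + 1) = 4 * a m * q + 2 * a m := by ring
      omega
  -- No whole pair is left in stage `m`, so the first pair of stage `m + 1` is used; `m + 1 ≤ n`
  -- because stage `n` ends no earlier than `T + 4 * a n`.
  · have hend : stageStart a b w (m + 1) < T + 4 * a m := by
      have h1 : 2 * a m * b.length ≤ 2 * a m * (2 * q) := Nat.mul_le_mul_left _ (by omega)
      have e : 2 * a m * (2 * q) = 4 * a m * q := by ring
      rw [stageStart_succ]
      omega
    have hne : m ≠ n := by rintro rfl; omega
    have ham' : a (m + 1) ≤ a n := ha (by omega)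
    obtain ⟨j, hj1, hj2, hj, hbj⟩ := hb.exists_true (q := 0) (by simpa using hb.pos)
    refine ⟨m + 1, j, by omega, hj, hbj, by omega, ?_⟩
    have : 2 * a (m + 1) * j ≤ 2 * a (m + 1) * 1 := Nat.mul_le_mul_left _ (by omega)
    omega

/-- If one agent starts stage `n + 1` well before the other one, they meet. -/
theorem Timetable.exists_meet_of_late (X : Timetable a i b w v v' pos)
    (Y : Timetable a i b' w' v' v pos') (hb : IsPaired b) (hb' : IsPaired b') (ha : Monotone a)
    (hpos : ∀ m, i ≤ m → 0 < a m) {n : ℕ} (h4 : 4 * a n ≤ a (n + 1)) (hin : i ≤ n)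
    (hi : stageStart a b' w' i ≤ stageStart a b w (n + 1))
    (hlate : stageStart a b w (n + 1) + 4 * a n ≤ stageStart a b' w' (n + 1)) :
    ∃ T, stageStart a b w (n + 1) ≤ T ∧ T ≤ stageStart a b w (n + 1) + 8 * a n ∧
      pos T = pos' T := by
  obtain ⟨m, j, him, hj, hbj, h1, h2⟩ := hb'.exists_active_block ha hpos hin hi hlate
  obtain ⟨t, ht, hpt⟩ := Y.active m him j hj hbj 0 (by omega)
  -- Block `0` of stage `n + 1` is idle and lasts `2 * a (n + 1) ≥ 8 * a n` rounds, which covers the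
  -- visit.
  have hidle := X.idle (n + 1) 0 hb.pos hb.head
    (stageStart a b' w' m + 2 * a m * j + (0 * a m + t) - stageStart a b w (n + 1)) (by omega)
  refine ⟨stageStart a b' w' m + 2 * a m * j + (0 * a m + t), by omega, by omega, ?_⟩
  rw [hpt, ← hidle]
  congr 1
  omega

/-- If two agents start a stage at about the same time and some bits at the same position differ,
they meet. -/
theorem Timetable.exists_meet_of_ne (X : Timetable a i b w v v' pos)
    (Y : Timetable a i b' w' v' v pos') {n j : ℕ} (hin : i ≤ n)
    (hle : stageStart a b w n ≤ stageStart a b' w' n)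
    (hle' : stageStart a b' w' n ≤ stageStart a b w n + a n) (hj : j < b.length)
    (hj' : j < b'.length) (hne : b.getD j false ≠ b'.getD j false) :
    ∃ T, stageStart a b w n ≤ T ∧ T ≤ stageStart a b' w' n + 2 * a n * (j + 1) ∧
      pos T = pos' T := by
  have e : 2 * a n * (j + 1) = 2 * a n * j + 2 * a n := by ring
  cases hbj : b.getD j false with
  | true =>
    have hbj' : b'.getD j false = false := by rw [hbj] at hne; simpa using hne.symm
    -- The earlier agent is active: its second exploration begins once the other's idle block has
    -- begun.
    obtain ⟨t, ht, hpt⟩ := X.active n hin j hj hbj 1 le_rfl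
    have hidle := Y.idle n j hj' hbj' (stageStart a b w n + 2 * a n * j + (1 * a n + t) -
      (stageStart a b' w' n + 2 * a n * j)) (by omega)
    refine ⟨stageStart a b w n + 2 * a n * j + (1 * a n + t), by omega, by omega, ?_⟩
    rw [hpt, ← hidle]
    congr 1
    omega
  | false =>
    have hbj' : b'.getD j false = true := by rw [hbj] at hne; simpa using hne.symm
    -- The later agent is active: its first exploration ends before the other's idle block does.
    obtain ⟨t, ht, hpt⟩ := Y.active n hin j hj' hbj' 0 (by omega)
    have hidle := X.idle n j hj hbj (stageStart a b' w' n + 2 * a n * j + (0 * a n + t) -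
      (stageStart a b w n + 2 * a n * j)) (by omega)
    refine ⟨stageStart a b' w' n + 2 * a n * j + (0 * a n + t), by omega, by omega, ?_⟩
    rw [hpt, ← hidle]
    congr 1
    omega

/-- Two bit sequences that differ at a common position or differ much in length. -/
def Separated (b b' : List Bool) : Prop :=
  (∃ j, j < b.length ∧ j < b'.length ∧ b.getD j false ≠ b'.getD j false) ∨
    b.length + 4 ≤ b'.length ∨ b'.length + 4 ≤ b.length

theorem Separated.symm (h : Separated b b') : Separated b' b := by
  rcases h with ⟨j, h1, h2, h3⟩ | h | h
  · exact Or.inl ⟨j, h2, h1, h3.symm⟩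
  · exact Or.inr (Or.inr h)
  · exact Or.inr (Or.inl h)

/-- A large lag gives a meeting at once. With a small lag, either a bit differs and the aligned
blocks meet, or the difference in length creates a large lag one stage later. -/
theorem Timetable.exists_meet_of_stageStart_le (X : Timetable a i b w v v' pos)
    (Y : Timetable a i b' w' v' v pos') (hb : IsPaired b) (hb' : IsPaired b')
    (hsep : Separated b b') (ha : Monotone a)
    (hpos : ∀ m, i ≤ m → 0 < a m) {n : ℕ} (h4 : ∀ n, 4 * a n ≤ a (n + 1)) (hin : i ≤ n)
    (hi : stageStart a b' w' i ≤ stageStart a b w (n + 1))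
    (hle : stageStart a b w (n + 1) ≤ stageStart a b' w' (n + 1)) :
    ∃ T, stageStart a b w (n + 1) ≤ T ∧
      T ≤ stageStart a b w (n + 1 + 1) + 8 * a (n + 1) ∧
      T ≤ stageStart a b' w' (n + 1 + 1) + 8 * a (n + 1) ∧ pos T = pos' T := by
  have h4n := h4 n
  have ex := stageStart_succ a b w (n + 1)
  have ey := stageStart_succ a b' w' (n + 1)
  rcases le_total (stageStart a b w (n + 1) + 4 * a n) (stageStart a b' w' (n + 1)) with h | h
  · obtain ⟨T, h1, h2, h3⟩ := X.exists_meet_of_late Y hb hb' ha hpos h4n hin hi h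
    exact ⟨T, h1, by omega, by omega, h3⟩
  · have hiy : stageStart a b w i ≤ stageStart a b w (n + 1) := stageStart_mono a b w (by omega)
    rcases hsep with ⟨j, hj, hj', hne⟩ | hk | hk
    · obtain ⟨T, h1, h2, h3⟩ := X.exists_meet_of_ne Y (n := n + 1) (by omega) hle (by omega) hj hj'
        hne
      have hjk : 2 * a (n + 1) * (j + 1) ≤ 2 * a (n + 1) * b.length := Nat.mul_le_mul_left _ hj
      have hjk' : 2 * a (n + 1) * (j + 1) ≤ 2 * a (n + 1) * b'.length := Nat.mul_le_mul_left _ hj'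
      exact ⟨T, h1, by omega, by omega, h3⟩
    · have hkk : 2 * a (n + 1) * (b.length + 4) ≤ 2 * a (n + 1) * b'.length :=
        Nat.mul_le_mul_left _ hk
      rw [mul_add] at hkk
      obtain ⟨T, h1, h2, h3⟩ := X.exists_meet_of_late Y hb hb' ha hpos (h4 (n + 1)) (by omega)
        (by omega) (by omega)
      exact ⟨T, by omega, by omega, by omega, h3⟩
    -- Here the lagging agent overtakes: it gains at least `8 * a (n + 1)` and lagged by at most `4
    -- * a n ≤ a (n + 1)`, so its lead exceeds the required `4 * a (n + 1)`.
    · have hkk : 2 * a (n + 1) * (b'.length + 4) ≤ 2 * a (n + 1) * b.length :=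
        Nat.mul_le_mul_left _ hk
      rw [mul_add] at hkk
      obtain ⟨T, h1, h2, h3⟩ := Y.exists_meet_of_late X hb' hb ha hpos (h4 (n + 1)) (by omega)
        (by omega) (by omega)
      exact ⟨T, by omega, by omega, by omega, h3.symm⟩

/-- If both agents have reached stage `i` when the first of them starts stage `n + 1`, then they
meet soon after the first of them ends stage `n + 1`. -/
theorem Timetable.exists_meet (X : Timetable a i b w v v' pos)
    (Y : Timetable a i b' w' v' v pos') (hb : IsPaired b) (hb' : IsPaired b')
    (hsep : Separated b b') (ha : Monotone a)
    (hpos : ∀ m, i ≤ m → 0 < a m) {n : ℕ} (h4 : ∀ n, 4 * a n ≤ a (n + 1)) (hin : i ≤ n)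
    (hi : stageStart a b' w' i ≤ stageStart a b w (n + 1))
    (hi' : stageStart a b w i ≤ stageStart a b' w' (n + 1)) :
    ∃ T, min w w' ≤ T ∧ T ≤ stageStart a b w (n + 1 + 1) + 8 * a (n + 1) ∧
      T ≤ stageStart a b' w' (n + 1 + 1) + 8 * a (n + 1) ∧ pos T = pos' T := by
  have hw := le_stageStart a b w (n + 1)
  have hw' := le_stageStart a b' w' (n + 1)
  rcases le_total (stageStart a b w (n + 1)) (stageStart a b' w' (n + 1)) with h | h
  · obtain ⟨T, h1, h2, h3, h4⟩ := X.exists_meet_of_stageStart_le Y hb hb' hsep ha hpos h4 hin hi h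
    exact ⟨T, by omega, h2, h3, h4⟩
  · obtain ⟨T, h1, h2, h3, h4⟩ :=
      Y.exists_meet_of_stageStart_le X hb' hb hsep.symm ha hpos h4 hin hi' h
    exact ⟨T, by omega, h3, h2, h4.symm⟩

/-! ### Bound on the meeting time -/

theorem sum_range_succ_le_two_mul (h4 : ∀ n, 4 * a n ≤ a (n + 1)) (n : ℕ) :
    ∑ m ∈ Finset.range (n + 1), a m ≤ 2 * a n := by
  induction n with
  | zero => simp; omega
  | succ n ih =>
    rw [Finset.sum_range_succ]
    have := h4 n
    omega

/-- The time bound, for a first agent woken up no later than the second one. -/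
theorem Timetable.exists_meet_le (X : Timetable a i b w v v' pos)
    (Y : Timetable a i b' w' v' v pos') (hb : IsPaired b) (hb' : IsPaired b')
    (hsep : Separated b b') (hpos : 0 < a i) (h4 : ∀ n, 4 * a n ≤ a (n + 1)) {R K : ℕ}
    (hR : ∀ n, i ≤ n → a (n + 1) ≤ R * a n) (hK : b.length ≤ K) (hK' : b'.length ≤ K)
    (hw : w ≤ w') :
    ∃ T, w ≤ T ∧ T ≤ w + 8 * (1 + R + 5 * (R * R)) * (K * a i) ∧ pos T = pos' T := by
  have ha : Monotone a := monotone_nat_of_le_succ fun n => by have := h4 n; omega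
  have hpos' : ∀ m, i ≤ m → 0 < a m := fun m hm => hpos.trans_le (ha hm)
  have hsum := sum_range_succ_le_two_mul h4 i
  have hstart : ∀ c : List Bool, c.length ≤ K →
      2 * c.length * ∑ m ∈ Finset.range (i + 1), a m ≤ 4 * (K * a i) := fun c hc =>
    calc 2 * c.length * ∑ m ∈ Finset.range (i + 1), a m ≤ 2 * K * (2 * a i) := by gcongr
      _ = _ := by ring
  have hR1 : 1 ≤ R := by
    by_contra h
    have h1 := hR i le_rfl
    have h2 := h4 i
    have : R = 0 := by omega
    subst this
    omega
  have hKa : K * a i ≤ R * (R * (K * a i)) :=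
    (Nat.le_mul_of_pos_left _ hR1).trans (Nat.le_mul_of_pos_left _ hR1)
  have hexp : 8 * (1 + R + 5 * (R * R)) * (K * a i) =
    8 * (K * a i) + 8 * (R * (K * a i)) + 40 * (R * (R * (K * a i))) := by ring
  have hk1 : 2 ≤ b.length := by obtain ⟨h, hh⟩ := hb.even; have := hb.pos; omega
  have hk1' : 2 ≤ b'.length := by obtain ⟨h, hh⟩ := hb'.even; have := hb'.pos; omega
  have hx := hstart b hK
  have hy := hstart b' hK'
  rcases le_or_gt (stageStart a b w (i + 1)) w' with hlate | hlate
  -- The second agent sleeps until the first has finished stage `i`, so any active block of that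
  -- stage finds it.
  · obtain ⟨j, -, hj1, hj, hbj⟩ := hb.exists_true (q := 0) (by omega)
    obtain ⟨t, ht, hpt⟩ := X.active i le_rfl j hj hbj 0 (by omega)
    have hjk : 2 * a i * (j + 1) ≤ 2 * a i * b.length := Nat.mul_le_mul_left _ hj
    rw [mul_add] at hjk
    have e := stageStart_succ a b w i
    have hwi := le_stageStart a b w i
    have e' : stageStart a b w (i + 1) = w + 2 * b.length * ∑ m ∈ Finset.range (i + 1), a m := rfl
    refine ⟨_, ?_, ?_, hpt.trans (Y.asleep _ ?_).symm⟩ <;> omega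
  · have ex : stageStart a b w (i + 1) = w + 2 * b.length * ∑ m ∈ Finset.range (i + 1), a m := rfl
    have ey : stageStart a b' w' (i + 1) = w' + 2 * b'.length * ∑ m ∈ Finset.range (i + 1), a m :=
      rfl
    have mx := stageStart_mono a b w (Nat.le_add_right i 1)
    have my := stageStart_mono a b' w' (Nat.le_add_right i 1)
    have hgrow : ∀ (c : List Bool) (u n : ℕ), 2 ≤ c.length → n ≤ stageStart a c u (i + n) := by
      intro c u n hc
      induction n with
      | zero => omega
      | succ n ih =>
        have h1 := hpos' (i + n) (by omega)
        have h2 : 2 * a (i + n) * 2 ≤ 2 * a (i + n) * c.length := Nat.mul_le_mul_left _ hc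
        rw [← add_assoc, stageStart_succ]
        omega
    -- Every stage from `i` on takes time, so stage starts are unbounded and a suitable `n` exists;
    -- the least one is used below.
    have hex : ∃ n, i ≤ n ∧ stageStart a b' w' i ≤ stageStart a b w (n + 1) ∧
        stageStart a b w i ≤ stageStart a b' w' (n + 1) := by
      refine ⟨i + (stageStart a b' w' i + stageStart a b w i), by omega, ?_, ?_⟩
      · have := hgrow b w (stageStart a b' w' i + stageStart a b w i + 1) hk1
        rw [← add_assoc] at this
        omega
      · have := hgrow b' w' (stageStart a b' w' i + stageStart a b w i + 1) hk1'
        rw [← add_assoc] at this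
        omega
    classical
    obtain ⟨hin, hi1, hi2⟩ := Nat.find_spec hex
    have hmin := fun m => Nat.find_min hex (m := m)
    generalize Nat.find hex = n at hin hi1 hi2 hmin
    obtain ⟨T, hT, hT1, hT2, hpT⟩ := X.exists_meet Y hb hb' hsep ha hpos' h4 hin hi1 hi2
    refine ⟨T, by omega, ?_, hpT⟩
    -- An agent that starts stage `n` early ends stage `n + 1` early.
    have hbound : ∀ (c : List Bool) (u : ℕ), 2 ≤ c.length → w ≤ u → i < n →
        T ≤ stageStart a c u (n + 1 + 1) + 8 * a (n + 1) →
        stageStart a c u n ≤ w + 8 * (K * a i) →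
        T ≤ w + 8 * (1 + R + 5 * (R * R)) * (K * a i) := by
      intro c u hc hu hn hTc hs
      obtain ⟨n, rfl⟩ : ∃ m, n = m + 1 := ⟨n - 1, by omega⟩
      have hn1 := hR n (by omega)
      have hn2 := hR (n + 1) (by omega)
      rw [stageStart_succ a c u (n + 1 + 1), stageStart_succ a c u (n + 1)] at hTc
      have hc1 := stageStart_succ a c u n
      have hc2 := le_stageStart a c u n
      -- Stage `n`, after the shift of the index, lies between rounds `w` and `w + 8 * (K * a i)`;
      -- the next two stages are longer by factors of at most `R` and `R * R`.
      have hca : a n * c.length ≤ 4 * (K * a i) := by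
        rw [mul_assoc] at hc1
        omega
      have hca1 : a (n + 1) * c.length ≤ R * (4 * (K * a i)) :=
        calc a (n + 1) * c.length ≤ R * a n * c.length := by gcongr
          _ = R * (a n * c.length) := by ring
          _ ≤ _ := by gcongr
      have hca2 : a (n + 1 + 1) * c.length ≤ R * (R * (4 * (K * a i))) :=
        calc a (n + 1 + 1) * c.length ≤ R * a (n + 1) * c.length := by gcongr
          _ = R * (a (n + 1) * c.length) := by ring
          _ ≤ _ := by gcongr
      have hca3 : a (n + 1 + 1) * 2 ≤ a (n + 1 + 1) * c.length := Nat.mul_le_mul_left _ hc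
      have e1 : R * (R * (4 * (K * a i))) = 4 * (R * (R * (K * a i))) := by ring
      have e2 : R * (4 * (K * a i)) = 4 * (R * (K * a i)) := by ring
      rw [mul_assoc 2, mul_assoc 2] at hTc
      omega
    rcases hin.eq_or_lt with rfl | hlt
    · have hRi := hR i le_rfl
      have hs2 := stageStart_succ a b w (i + 1)
      have h1 : a (i + 1) * b.length ≤ R * (K * a i) :=
        calc a (i + 1) * b.length ≤ R * a i * K := by gcongr
          _ = _ := by ring
      have h2 : a (i + 1) * 2 ≤ a (i + 1) * b.length := Nat.mul_le_mul_left _ hk1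
      rw [mul_assoc 2] at hs2
      omega
    -- By minimality the condition fails one stage earlier: one agent starts stage `n` before the
    -- other starts stage `i`, hence by round `w + 8 * (K * a i)`.
    · by_cases hxn : stageStart a b' w' i ≤ stageStart a b w n
      · by_cases hyn : stageStart a b w i ≤ stageStart a b' w' n
        · refine absurd ⟨?_, ?_⟩ (hmin (n - 1) (by omega))
          · omega
          · rw [Nat.sub_add_cancel (by omega)]
            exact ⟨hxn, hyn⟩
        · exact hbound b' w' hk1' hw hlt hT2 (by omega)
      · exact hbound b w hk1 le_rfl hlt hT1 (by omega)

end

namespace URT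

/-! ### The transformed label -/

/-- The word that replaces a bit of the label. -/
def code (b : Bool) : List Bool :=
  if b then [false, true, false, true, false, true] else [true, false, true, false, true, false]

theorem length_code (b : Bool) : (code b).length = 6 := by cases b <;> rfl

theorem trans_eq (l : ℕ) : trans l = l.bits.reverse.flatMap code := rfl

theorem length_flatMap_code (s : List Bool) : (s.flatMap code).length = 6 * s.length := by
  induction s with
  | nil => rfl
  | cons b s ih =>
    rw [List.flatMap_cons, List.length_append, ih, length_code, List.length_cons]
    ring

theorem length_trans (l : ℕ) : (trans l).length = 6 * l.size := by
  rw [trans_eq, length_flatMap_code, List.length_reverse, Nat.size_eq_bits_len]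

theorem flatMap_code_injective : Function.Injective fun s : List Bool => s.flatMap code := by
  intro s
  induction s with
  | nil =>
    rintro (_ | ⟨b, s'⟩) h
    · rfl
    · cases b <;> simp [code] at h
  | cons b s ih =>
    rintro (_ | ⟨b', s'⟩) h
    · cases b <;> simp [code] at h
    · simp only [List.flatMap_cons] at h
      obtain ⟨h1, h2⟩ := List.append_inj h (by rw [length_code, length_code])
      have hb : b = b' := by
        cases b <;> cases b' <;> simp [code] at h1 <;> rfl
      rw [hb, ih h2]

theorem trans_injective : Function.Injective trans := fun l l' h => by
  have h1 := List.reverse_injective (flatMap_code_injective h)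
  exact Nat.eq_of_testBit_eq fun i => by rw [Nat.testBit_eq_inth, Nat.testBit_eq_inth, h1]

theorem getD_flatMap_code_ne (s : List Bool) (q : ℕ) (hq : 2 * q < (s.flatMap code).length) :
    (s.flatMap code).getD (2 * q) false ≠ (s.flatMap code).getD (2 * q + 1) false := by
  induction s generalizing q with
  | nil => simp at hq
  | cons b s ih =>
    rw [List.flatMap_cons] at hq ⊢
    rw [List.length_append, length_code] at hq
    rcases lt_or_ge q 3 with h | h
    · rw [List.getD_append _ _ _ _ (by rw [length_code]; omega),
        List.getD_append _ _ _ _ (by rw [length_code]; omega)]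
      interval_cases q <;> cases b <;> simp [code]
    · rw [List.getD_append_right _ _ _ _ (by rw [length_code]; omega),
        List.getD_append_right _ _ _ _ (by rw [length_code]; omega), length_code]
      have := ih (q - 3) (by omega)
      rwa [show 2 * (q - 3) = 2 * q - 6 by omega,
        show 2 * q - 6 + 1 = 2 * q + 1 - 6 by omega] at this

theorem exists_bits_reverse_eq_cons {l : ℕ} (hl : 1 ≤ l) : ∃ s, l.bits.reverse = true :: s := by
  induction l using Nat.binaryRec with
  | zero => omega
  | bit b n ih =>
    rcases Nat.eq_zero_or_pos n with rfl | hn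
    · cases b
      · simp at hl
      · exact ⟨[], by simp⟩
    · obtain ⟨s, hs⟩ := ih hn
      rw [Nat.bits_append_bit n b (by omega), List.reverse_cons, hs]
      exact ⟨s ++ [b], rfl⟩

theorem isPaired_trans {l : ℕ} (hl : 1 ≤ l) : IsPaired (trans l) where
  even := by rw [length_trans]; exact ⟨3 * l.size, by ring⟩
  pos := by
    have := Nat.size_pos.mpr hl
    rw [length_trans]
    omega
  ne := getD_flatMap_code_ne _
  head := by
    obtain ⟨s, hs⟩ := exists_bits_reverse_eq_cons hl
    rw [trans_eq, hs]
    rfl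

/-- Lengths are multiples of `6`, so unequal lengths differ by at least `6`; with equal lengths,
injectivity of `trans` yields a differing bit. -/
theorem separated_trans {l l' : ℕ} (h : l ≠ l') : Separated (trans l) (trans l') := by
  rcases lt_trichotomy (trans l).length (trans l').length with hlt | heq | hlt
  · rw [Separated, length_trans, length_trans] at *
    omega
  · left
    by_contra hno
    push Not at hno
    refine h (trans_injective (List.ext_getElem heq fun j hj hj' => ?_))
    have := hno j hj hj'
    rwa [List.getD_eq_getElem _ _ hj, List.getD_eq_getElem _ _ hj'] at this
  · rw [Separated, length_trans, length_trans] at *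
    omega

/-! ### The length of the blocks -/

theorem a_succ (d r : ℕ) : a d (r + 1) = 2 * d + (d - 1) * a d r := by
  have h : ∀ r, a d r = 2 * d * ∑ k ∈ Finset.range r, (d - 1) ^ k := fun r => by
    rw [a, z, ← Finset.mul_sum, Nat.add_sub_cancel_left, mul_assoc]
  rw [h, h, Finset.sum_range_succ']
  simp only [pow_succ, ← Finset.sum_mul]
  ring

theorem a_mono (d : ℕ) : Monotone (a d) := by
  refine monotone_nat_of_le_succ fun r => ?_
  simp only [a, z, Finset.sum_range_succ]
  omega

theorem le_a (d : ℕ) {r : ℕ} (hr : 1 ≤ r) : 2 * d ≤ a d r := by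
  have := a_mono d hr
  rw [show (1 : ℕ) = 0 + 1 from rfl, a_succ] at this
  omega

theorem a_le_two_mul_z (d r : ℕ) : a d r ≤ 2 * z d r := by
  rw [a]; omega

theorem a_succ_le {d r : ℕ} (hd : 2 ≤ d) (hr : 1 ≤ r) : a d (r + 1) ≤ d * a d r := by
  have h := le_a d hr
  obtain ⟨e, rfl⟩ : ∃ e, d = e + 1 := ⟨d - 1, by omega⟩
  rw [a_succ, Nat.add_sub_cancel, add_mul]
  omega

theorem a_two (r : ℕ) : a 2 r = 4 * r := by
  simp [a, z]
  ring

theorem radius_two (i : ℕ) : radius 2 i = 4 ^ i := by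
  rw [radius, if_pos rfl, pow_mul]; norm_num

/-- On a line balls grow linearly, so the radius is quadrupled; for `d > 2`, two more levels
multiply the length by at least `(d - 1) ^ 2 ≥ 4`. -/
theorem four_mul_a_radius_le {d : ℕ} (hd : 2 ≤ d) (i : ℕ) :
    4 * a d (radius d i) ≤ a d (radius d (i + 1)) := by
  rcases hd.eq_or_lt with rfl | h3
  · rw [a_two, a_two, radius_two, radius_two, pow_succ]
    omega
  · rw [radius, radius, if_neg (by omega), if_neg (by omega),
      show 2 * (i + 1) = 2 * i + 1 + 1 by ring, a_succ, a_succ]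
    have h2 : 2 ≤ d - 1 := by omega
    have h1 : 2 * a d (2 * i) ≤ (d - 1) * a d (2 * i) := Nat.mul_le_mul_right _ h2
    have h3 : 2 * (2 * d + (d - 1) * a d (2 * i)) ≤ (d - 1) * (2 * d + (d - 1) * a d (2 * i)) :=
      Nat.mul_le_mul_right _ h2
    omega

theorem a_radius_succ_le {d i : ℕ} (hd : 2 ≤ d) (hi : 1 ≤ radius d i) :
    a d (radius d (i + 1)) ≤ d * d * a d (radius d i) := by
  rcases hd.eq_or_lt with rfl | h3
  · rw [a_two, a_two, radius_two, radius_two, pow_succ]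
    omega
  · rw [radius, if_neg (by omega)] at hi ⊢
    rw [radius, if_neg (by omega), show 2 * (i + 1) = 2 * i + 1 + 1 by ring, mul_assoc]
    exact (a_succ_le hd (by omega)).trans (Nat.mul_le_mul_left _ (a_succ_le hd hi))

theorem one_le_z (d r : ℕ) : 1 ≤ z d r := Nat.le_add_right _ _

/-- There is a stage whose radius is large enough, but not much larger than needed. -/
theorem exists_radius {d D : ℕ} (hd : 2 ≤ d) (hD : 1 ≤ D) :
    ∃ i, D ≤ radius d i ∧ a d (radius d i) ≤ 2 * (d * d) * z d D := by
  have hex : ∃ i, D ≤ radius d i := by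
    refine ⟨D, ?_⟩
    rcases hd.eq_or_lt with rfl | h3
    · rw [radius_two]
      exact (Nat.lt_pow_self (by norm_num)).le
    · rw [radius, if_neg (by omega)]; omega
  classical
  refine ⟨Nat.find hex, Nat.find_spec hex, ?_⟩
  have hmin := fun m => Nat.find_min hex (m := m)
  have hspec := Nat.find_spec hex
  generalize Nat.find hex = i at hmin hspec
  have hz := one_le_z d D
  rcases i with _ | i
  · rcases hd.eq_or_lt with rfl | h3
    · rw [a_two, radius_two]
      omega
    · rw [radius, if_neg (by omega)] at hspec
      omega
  · have hi := hmin i (by omega)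
    -- Radius `0` occurs only for `d > 2` in stage `0`. The growth bound is useless there, since `a
    -- d 0 = 0`, but `a d 2 = 2 * (d * d)` is computed directly.
    rcases Nat.eq_zero_or_pos (radius d i) with h0 | h0
    · rw [radius] at h0
      split_ifs at h0 with h2
      · simp at h0
      · obtain rfl : i = 0 := by omega
        rw [radius, if_neg h2, show 2 * (0 + 1) = 0 + 1 + 1 from rfl, a_succ, a_succ]
        obtain ⟨e, rfl⟩ : ∃ e, d = e + 1 := ⟨d - 1, by omega⟩
        have h00 : a (e + 1) 0 = 0 := by simp [a, z]
        rw [h00, Nat.add_sub_cancel]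
        calc 2 * (e + 1) + e * (2 * (e + 1) + e * 0) = 2 * ((e + 1) * (e + 1)) * 1 := by ring
          _ ≤ _ := Nat.mul_le_mul_left _ hz
    · calc a d (radius d (i + 1)) ≤ d * d * a d (radius d i) := a_radius_succ_le hd h0
        _ ≤ d * d * (2 * z d D) :=
          Nat.mul_le_mul_left _ ((a_mono d (by omega)).trans (a_le_two_mul_z d D))
        _ = _ := by ring

/-- The binary length is at most `1 + log₂ L`, and `1 ≤ log₂ L`. -/
theorem size_le_log {L : ℕ} (hL : 2 ≤ L) : (L.size : ℝ) ≤ 2 / Real.log 2 * Real.log L := by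
  have hlog2 : 0 < Real.log 2 := Real.log_pos (by norm_num)
  have hLr : (2 : ℝ) ≤ L := by exact_mod_cast hL
  have h1 : Real.log 2 ≤ Real.log L := Real.log_le_log (by norm_num) hLr
  have hs : 0 < L.size := Nat.size_pos.mpr (by omega)
  have h2 : 2 ^ (L.size - 1) ≤ L := Nat.lt_size.mp (by omega)
  have h3 : ((L.size - 1 : ℕ) : ℝ) * Real.log 2 ≤ Real.log L := by
    rw [← Real.log_pow]
    exact Real.log_le_log (by positivity) (by exact_mod_cast h2)
  rw [Nat.cast_sub hs, Nat.cast_one] at h3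
  rw [div_mul_eq_mul_div, le_div_iff₀ hlog2]
  linarith

end URT

/-! ### Algorithm URT as a timetable, and the theorem -/

namespace PortLabeling

variable {V : Type u} {G : SimpleGraph V} [G.LocallyFinite]

theorem timetable (P : PortLabeling G) {d : ℕ} (hG : G.Connected) (hd : G.IsRegularOfDegree d)
    (h2 : 2 ≤ d) {l : ℕ} (hl : 1 ≤ l) {v u : V} {i : ℕ} (hu : G.dist v u ≤ URT.radius d i)
    (w : ℕ) :
    Timetable (fun n => URT.a d (URT.radius d n)) i (URT.trans l) w v u (P.urtPosAt l v w) where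
  asleep t ht := by
    rw [urtPosAt, Nat.sub_eq_zero_of_le ht]
    rfl
  idle n j hj hb t ht := by
    rw [urtPosAt, stageStart, add_assoc, add_assoc, Nat.add_sub_cancel_left, ← add_assoc]
    exact urtPos_idle P hd h2 hl v n j t hj hb ht
  active n hn j hj hb h hh := by
    have hrad : URT.radius d i ≤ URT.radius d n := by
      unfold URT.radius
      split_ifs
      · exact Nat.pow_le_pow_right (by norm_num) (by omega)
      · omega
    obtain ⟨t, ht, hpt⟩ := urtPos_active P hG hd h2 hl v u n j h hj hb (hu.trans hrad) hh
    refine ⟨t, ht, ?_⟩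
    rw [urtPosAt, stageStart, add_assoc, add_assoc, Nat.add_sub_cancel_left, ← add_assoc]
    exact hpt

theorem exists_togetherAt_le (P : PortLabeling G) {d : ℕ} (hG : G.Connected)
    (hd : G.IsRegularOfDegree d) (h2 : 2 ≤ d) {L l₁ l₂ : ℕ} (hl₁ : 1 ≤ l₁) (hl₂ : 1 ≤ l₂)
    (hL₁ : l₁ ≤ L) (hL₂ : l₂ ≤ L) (hne : l₁ ≠ l₂) (v₁ v₂ : V) (w₁ w₂ : ℕ) :
    ∃ τ, P.TogetherAt l₁ l₂ v₁ v₂ w₁ w₂ τ ∧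
      τ ≤ 8 * (1 + d * d + 5 * (d * d * (d * d))) *
        (6 * L.size * (2 * (d * d) * URT.z d (G.dist v₁ v₂))) := by
  rcases Nat.eq_zero_or_pos (G.dist v₁ v₂) with h0 | hpos
  · obtain rfl := hG.dist_eq_zero_iff.mp h0
    refine ⟨0, ?_, Nat.zero_le _⟩
    rw [TogetherAt, urtPosAt, urtPosAt, add_zero, Nat.sub_eq_zero_of_le (min_le_left _ _),
      Nat.sub_eq_zero_of_le (min_le_right _ _)]
    rfl
  obtain ⟨i, hi, hai⟩ := URT.exists_radius h2 hpos
  have hi' : G.dist v₂ v₁ ≤ URT.radius d i := by rwa [SimpleGraph.dist_comm]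
  have hrad : ∀ n, i ≤ n → 1 ≤ URT.radius d n := fun n hn => by
    have h1 : 1 ≤ URT.radius d i := hpos.trans_le hi
    unfold URT.radius at h1 ⊢
    split_ifs at h1 ⊢
    · exact Nat.one_le_two_pow
    · omega
  have X := P.timetable hG hd h2 hl₁ hi w₁
  have Y := P.timetable hG hd h2 hl₂ hi' w₂
  have hK : ∀ l ≤ L, (URT.trans l).length ≤ 6 * L.size := fun l hl => by
    rw [URT.length_trans]
    exact Nat.mul_le_mul_left _ (Nat.size_le_size hl)
  have hai0 : 0 < URT.a d (URT.radius d i) :=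
    lt_of_lt_of_le (by omega) (URT.le_a d (hrad i le_rfl))
  have hR : ∀ n, i ≤ n → URT.a d (URT.radius d (n + 1)) ≤ d * d * URT.a d (URT.radius d n) :=
    fun n hn => URT.a_radius_succ_le h2 (hrad n hn)
  have hbound : 8 * (1 + d * d + 5 * (d * d * (d * d))) *
        (6 * L.size * URT.a d (URT.radius d i)) ≤ 8 * (1 + d * d + 5 * (d * d * (d * d))) *
        (6 * L.size * (2 * (d * d) * URT.z d (G.dist v₁ v₂))) := by gcongr
  rcases le_total w₁ w₂ with hw | hw
  · obtain ⟨T, h1, h3, hT⟩ := X.exists_meet_le Y (URT.isPaired_trans hl₁) (URT.isPaired_trans hl₂)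
      (URT.separated_trans hne) hai0 (URT.four_mul_a_radius_le h2) hR (hK l₁ hL₁) (hK l₂ hL₂) hw
    refine ⟨T - w₁, ?_, by omega⟩
    rw [TogetherAt, min_eq_left hw, Nat.add_sub_cancel' h1]
    exact hT
  · obtain ⟨T, h1, h3, hT⟩ := Y.exists_meet_le X (URT.isPaired_trans hl₂) (URT.isPaired_trans hl₁)
      (URT.separated_trans hne.symm) hai0 (URT.four_mul_a_radius_le h2) hR (hK l₂ hL₂) (hK l₁ hL₁)
      hw
    refine ⟨T - w₂, ?_, by omega⟩
    rw [TogetherAt, min_eq_right hw, Nat.add_sub_cancel' h1]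
    exact hT.symm

end PortLabeling

theorem mainTheorem1 (d : ℕ) (hd : 2 ≤ d) :
    ∃ C : ℝ, ∀ (V : Type u) (G : SimpleGraph V) [G.LocallyFinite] (P : PortLabeling G),
      G.IsTree → G.IsRegularOfDegree d →
      ∀ L l₁ l₂ : ℕ, l₁ ∈ Finset.Icc 1 L → l₂ ∈ Finset.Icc 1 L → l₁ ≠ l₂ →
      ∀ (D : ℕ) (v₁ v₂ : V), G.dist v₁ v₂ = D →
      ∀ w₁ w₂ : ℕ,
        ∃ τ : ℕ, IsLeast {τ : ℕ | P.TogetherAt l₁ l₂ v₁ v₂ w₁ w₂ τ} τ ∧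
          ∀ x : V, (τ : ℝ) ≤ C * (ballSize G x D : ℝ) * Real.log (L : ℝ) := by
  classical
  -- The factors come from the meeting bound with `R = d * d`, the `6` letters per label bit, the
  -- ratio of `a d (radius d i)` to `z d D`, and the passage from binary length to logarithm.
  refine ⟨8 * (1 + d * d + 5 * (d * d * (d * d))) * 6 * (2 * (d * d)) * (2 / Real.log 2), ?_⟩
  rintro V G _ P hG hreg L l₁ l₂ hl₁ hl₂ hne D v₁ v₂ rfl w₁ w₂
  rw [Finset.mem_Icc] at hl₁ hl₂
  obtain ⟨τ, hτ, hle⟩ := P.exists_togetherAt_le hG.connected hreg hd hl₁.1 hl₂.1 hl₁.2 hl₂.2 hne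
    v₁ v₂ w₁ w₂
  have hex : ∃ τ, P.TogetherAt l₁ l₂ v₁ v₂ w₁ w₂ τ := ⟨τ, hτ⟩
  refine ⟨Nat.find hex, ⟨Nat.find_spec hex, fun σ hσ => Nat.find_min' hex hσ⟩, fun x => ?_⟩
  have hfind := (Nat.find_min' hex hτ).trans hle
  rw [ballSize_eq_z hG hreg]
  -- Two different labels in `{1, …, L}` force `L ≥ 2`.
  have hsize := URT.size_le_log (L := L) (by omega)
  calc ((Nat.find hex : ℕ) : ℝ) ≤ ((8 * (1 + d * d + 5 * (d * d * (d * d))) *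
        (6 * L.size * (2 * (d * d) * URT.z d (G.dist v₁ v₂))) : ℕ) : ℝ) := by exact_mod_cast hfind
    _ = 8 * (1 + d * d + 5 * (d * d * (d * d))) * 6 * (2 * (d * d)) *
        (URT.z d (G.dist v₁ v₂) : ℝ) * (L.size : ℝ) := by push_cast; ring
    _ ≤ 8 * (1 + d * d + 5 * (d * d * (d * d))) * 6 * (2 * (d * d)) *
        (URT.z d (G.dist v₁ v₂) : ℝ) * (2 / Real.log 2 * Real.log L) := by gcongr
    _ = _ := by ring
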